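/- Let $q$ be a complex number with $|q|<1$. Write $(a;q)_n=\prod_{k=0}^{n-1}(1-aq^k)$ for $n\ge 0$ (so $(a;q)_0=1$), $(a;q)_\infty=\prod_{k=0}^{\infty}(1-aq^k)$, and $(a_1,a_2,a_3;q)_\infty=(a_1;q)_\infty(a_2;q)_\infty(a_3;q)_\infty$. Then the series below converges and $$\sum_{n=0}^{\infty}\frac{q^{2n^2+2n}}{(-q;q^2)_n\,(q;q)_{2n+1}}=\frac{(q^8,q^{20},q^{28};q^{28})_\infty+q\,(q^4,q^{24},q^{28};q^{28})_\infty}{(q^2;q^2)_\infty}.$$ -/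

import Mathlib

/-- The finite `q`-shifted factorial `(a; q)_n = ∏_{k=0}^{n-1} (1 - a q^k)`. -/
noncomputable def qPoch (a q : ℂ) (n : ℕ) : ℂ :=
  ∏ k ∈ Finset.range n, (1 - a * q ^ k)

/-- The infinite `q`-shifted factorial `(a; q)_∞ = ∏_{k=0}^{∞} (1 - a q^k)`. -/
noncomputable def qPochInf (a q : ℂ) : ℂ :=
  ∏' k : ℕ, (1 - a * q ^ k)

/-- For `|q| < 1` the infinite product converges, so `qPochInf` is its actual value. -/
theorem hasProd_qPochInf (a q : ℂ) (hq : ‖q‖ < 1) :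
    HasProd (fun k : ℕ => 1 - a * q ^ k) (qPochInf a q) := by
  have hs : Summable (fun k : ℕ => ‖-(a * q ^ k)‖) := by
    simpa [norm_mul, norm_pow] using
      (summable_geometric_of_lt_one (norm_nonneg q) hq).mul_left ‖a‖
  have hm := multipliable_one_add_of_summable hs
  simpa [qPochInf, sub_eq_add_neg] using hm.hasProd

/-!
Over the common denominator `(q²; q²)_n (q²; q⁴)_{n+1}` the summand acquires the factor
`1 + q^{2n+1}`, so the series splits into the left-hand sides of Slater's identities (60) and (59)
modulo 14, taken at `q²` in place of `q`.

Both identities come from bilateral sums `S(i, j) = ∑_m c_m / ((q)_{i-tm} (q)_{j+tm})`. A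
`q`-Pascal rule for the product of two reciprocals relates `S(i, j)` to `S(i, j - 1)` and to
`S(i - 1, j)` with `c_m` rescaled by `q^{tm}`. Theta coefficients keep their shape under this
rescaling, so for them the recurrence closes up: for `t = 1` it evaluates `S(n, n)` as a product,
whose limit is the Jacobi triple product, and for `t = 2`, `c_m = (-1)^m q^{3m² + m}` it gives
`S(n, n + 1) = S(n, n + 2) = 1 / ((q; q)_n (q; q²)_{n+1})`.

By the Durfee rectangle identity `∑_n q^{n(n+d)} / ((q)_n (q)_{n+d}) = 1 / (q)_∞`, summing
`q^{n(n+a)} S(n, n + a)` over `n` collapses to `(q)_∞⁻¹ ∑_m c_m q^{tm(tm+a)}`. In the second case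
this is a theta series with base `q^14`, which the triple product evaluates.
-/

open Filter Topology

theorem qPoch_succ (a q : ℂ) (n : ℕ) : qPoch a q (n + 1) = qPoch a q n * (1 - a * q ^ n) :=
  Finset.prod_range_succ _ n

theorem qPoch_neg_mul_qPoch (a q : ℂ) (n : ℕ) :
    qPoch (-a) q n * qPoch a q n = qPoch (a ^ 2) (q ^ 2) n := by
  rw [qPoch, qPoch, qPoch, ← Finset.prod_mul_distrib]
  exact Finset.prod_congr rfl fun k _ => by ring

theorem qPoch_two_mul_add_one (a q : ℂ) (n : ℕ) :
    qPoch a q (2 * n + 1) = qPoch a (q ^ 2) (n + 1) * qPoch (a * q) (q ^ 2) n := by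
  induction n with
  | zero => simp [qPoch]
  | succ n ih =>
    rw [show 2 * (n + 1) + 1 = 2 * n + 1 + 1 + 1 by ring, qPoch_succ, qPoch_succ, ih,
      qPoch_succ a _ (n + 1), qPoch_succ (a * q) _ n]
    ring

theorem tendsto_qPoch (a : ℂ) {q : ℂ} (hq : ‖q‖ < 1) :
    Tendsto (qPoch a q) atTop (𝓝 (qPochInf a q)) :=
  (hasProd_qPochInf a q hq).tendsto_prod_nat

section NonVanishing

variable {q : ℂ} (hq : ‖q‖ < 1)
include hq

theorem norm_pow_lt_one {k : ℕ} (hk : k ≠ 0) : ‖q ^ k‖ < 1 := by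
  rw [norm_pow]
  exact pow_lt_one₀ (norm_nonneg q) hq hk

theorem one_sub_pow_ne_zero {k : ℕ} (hk : k ≠ 0) : 1 - q ^ k ≠ 0 := fun h => by
  have hlt := norm_pow_lt_one hq hk
  rw [← sub_eq_zero.mp h, norm_one] at hlt
  exact lt_irrefl _ hlt

theorem one_add_pow_ne_zero {k : ℕ} (hk : k ≠ 0) : 1 + q ^ k ≠ 0 := fun h => by
  refine one_sub_pow_ne_zero hq (mul_ne_zero hk two_ne_zero) ?_
  linear_combination (1 - q ^ k) * h

theorem one_sub_zpow_ne_zero {k : ℤ} (hk : 0 < k) : 1 - q ^ k ≠ 0 := by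
  lift k to ℕ using hk.le
  exact_mod_cast one_sub_pow_ne_zero hq (by lia)

theorem one_sub_self_mul_pow_ne_zero (k : ℕ) : 1 - q * q ^ k ≠ 0 := by
  rw [← pow_succ']
  exact one_sub_pow_ne_zero hq k.succ_ne_zero

theorem qPochInf_self_ne_zero : qPochInf q q ≠ 0 := by
  have hs : Summable fun k : ℕ => ‖-(q * q ^ k)‖ := by
    simpa only [norm_neg, ← pow_succ', norm_pow] using
      (summable_nat_add_iff 1).mpr (summable_geometric_of_lt_one (norm_nonneg q) hq)
  simpa only [qPochInf, sub_eq_add_neg] using tprod_one_add_ne_zero_of_summable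
    (fun k => by simpa only [sub_eq_add_neg] using one_sub_self_mul_pow_ne_zero hq k) hs

end NonVanishing

/-- The reciprocal `1 / (q; q)_k`, extended by `0` to negative `k`. The extension makes
`(q; q)_k = (1 - q ^ k) (q; q)_{k-1}`, read for reciprocals, valid at every integer `k`, so that
sums over `ℤ` can be shifted freely. -/
noncomputable def invQPoch (q : ℂ) (k : ℤ) : ℂ :=
  if k < 0 then 0 else (qPoch q q k.toNat)⁻¹

theorem invQPoch_natCast (q : ℂ) (n : ℕ) : invQPoch q n = (qPoch q q n)⁻¹ := by
  simp [invQPoch]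

theorem invQPoch_of_neg (q : ℂ) {k : ℤ} (hk : k < 0) : invQPoch q k = 0 :=
  if_pos hk

theorem invQPoch_zero (q : ℂ) : invQPoch q 0 = 1 := by
  simpa [qPoch] using invQPoch_natCast q 0

section InvQPoch

variable {q : ℂ} (hq : ‖q‖ < 1)
include hq

theorem invQPoch_sub_one (k : ℤ) : invQPoch q (k - 1) = (1 - q ^ k) * invQPoch q k := by
  rcases lt_trichotomy k 0 with hk | rfl | hk
  · rw [invQPoch_of_neg q hk, invQPoch_of_neg q (by lia), mul_zero]
  · rw [invQPoch_of_neg q (by lia), zpow_zero, sub_self, zero_mul]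
  · obtain ⟨n, rfl⟩ := Int.eq_succ_of_zero_lt hk
    have hn := one_sub_self_mul_pow_ne_zero hq n
    rw [add_sub_cancel_right, ← Nat.cast_succ, invQPoch_natCast, invQPoch_natCast, qPoch_succ,
      zpow_natCast, pow_succ', mul_inv, mul_left_comm, mul_inv_cancel₀ hn, mul_one]

theorem invQPoch_pascal (hq0 : q ≠ 0) (k l : ℤ) :
    (1 - q ^ (k + l)) * (invQPoch q k * invQPoch q l) =
      invQPoch q k * invQPoch q (l - 1) + q ^ l * (invQPoch q (k - 1) * invQPoch q l) := by
  rw [invQPoch_sub_one hq, invQPoch_sub_one hq, zpow_add₀ hq0]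
  ring

theorem tendsto_invQPoch : Tendsto (invQPoch q) atTop (𝓝 (qPochInf q q)⁻¹) := by
  rw [← Nat.map_cast_int_atTop, tendsto_map'_iff]
  exact ((tendsto_qPoch q hq).inv₀ (qPochInf_self_ne_zero hq)).congr fun n =>
    (invQPoch_natCast q n).symm

theorem exists_norm_invQPoch_mul_le :
    ∃ C, ∀ k l, ‖invQPoch q k * invQPoch q l‖ ≤ C := by
  obtain ⟨C, hC⟩ := ((tendsto_qPoch q hq).inv₀ (qPochInf_self_ne_zero hq)).norm.bddAbove_range
  have hnat (n : ℕ) : ‖invQPoch q n‖ ≤ C := by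
    rw [invQPoch_natCast]
    exact hC ⟨n, rfl⟩
  have hC0 : 0 ≤ C := (norm_nonneg _).trans (hnat 0)
  have hint (k : ℤ) : ‖invQPoch q k‖ ≤ C := by
    rcases lt_or_ge k 0 with hk | hk
    · rwa [invQPoch_of_neg q hk, norm_zero]
    · lift k to ℕ using hk
      exact hnat k
  refine ⟨C * C, fun k l => ?_⟩
  rw [norm_mul]
  exact mul_le_mul (hint k) (hint l) (norm_nonneg _) hC0

theorem summable_mul_invQPoch {ι : Type*} {c : ι → ℂ} (hc : Summable c) (k l : ι → ℤ) :
    Summable fun x => c x * (invQPoch q (k x) * invQPoch q (l x)) := by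
  obtain ⟨C, hC⟩ := exists_norm_invQPoch_mul_le hq
  refine Summable.of_norm_bounded (hc.norm.mul_right C) fun x => ?_
  rw [norm_mul]
  exact mul_le_mul_of_nonneg_left (hC _ _) (norm_nonneg _)

end InvQPoch

/-- The coefficient `(-1)^m p^{m(m-1)/2} z^m` of the theta series in the Jacobi triple product.
The integer division is exact. -/
noncomputable def thetaCoeff (p z : ℂ) (m : ℤ) : ℂ :=
  (-1) ^ m * p ^ (m * (m - 1) / 2) * z ^ m

theorem two_mul_mul_pred_div_two (m : ℤ) : 2 * (m * (m - 1) / 2) = m * (m - 1) :=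
  Int.mul_ediv_cancel' m.even_mul_pred_self.two_dvd

theorem thetaCoeff_zero (p z : ℂ) : thetaCoeff p z 0 = 1 := by
  simp [thetaCoeff]

theorem thetaCoeff_mul_zpow (p z q : ℂ) (t m : ℤ) :
    thetaCoeff p z m * q ^ (t * m) = thetaCoeff p (z * q ^ t) m := by
  rw [thetaCoeff, thetaCoeff, mul_zpow, ← zpow_mul, mul_assoc _ (z ^ m)]

theorem thetaCoeff_mul_zpow_mul_pred (p z q : ℂ) (t m : ℤ) :
    thetaCoeff p z m * q ^ (t * (m * (m - 1))) = thetaCoeff (p * q ^ (2 * t)) z m := by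
  have hexp : 2 * t * (m * (m - 1) / 2) = t * (m * (m - 1)) := by
    linear_combination t * two_mul_mul_pred_div_two m
  rw [thetaCoeff, thetaCoeff, mul_zpow, ← zpow_mul, hexp]
  ring

section ThetaCoeff

variable {p z : ℂ} (hp0 : p ≠ 0)
include hp0

theorem thetaCoeff_neg (m : ℤ) : thetaCoeff p z (-m) = thetaCoeff p (p / z) m := by
  have hexp : -m * (-m - 1) / 2 = m * (m - 1) / 2 + m := by
    have h₁ := two_mul_mul_pred_div_two m
    have h₂ := two_mul_mul_pred_div_two (-m)
    linarith
  rw [thetaCoeff, thetaCoeff, hexp, zpow_add₀ hp0, div_zpow, zpow_neg z, zpow_neg (-1 : ℂ),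
    ← inv_zpow, inv_neg_one]
  ring

theorem thetaCoeff_add_one (hz : z ≠ 0) (m : ℤ) :
    thetaCoeff p z (m + 1) = -z * p ^ m * thetaCoeff p z m := by
  have hexp : (m + 1) * (m + 1 - 1) / 2 = m + m * (m - 1) / 2 := by
    have h₁ := two_mul_mul_pred_div_two m
    have h₂ := two_mul_mul_pred_div_two (m + 1)
    linarith
  rw [thetaCoeff, thetaCoeff, hexp, zpow_add₀ hp0, zpow_add_one₀ (neg_ne_zero.mpr one_ne_zero),
    zpow_add_one₀ hz]
  ring

theorem summable_thetaCoeff_natCast (hp : ‖p‖ < 1) (hz : z ≠ 0) :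
    Summable fun n : ℕ => thetaCoeff p z n := by
  have hratio : Tendsto (fun n : ℕ => ‖z‖ * ‖p‖ ^ n) atTop (𝓝 0) := by
    simpa using (tendsto_pow_atTop_nhds_zero_of_lt_one (norm_nonneg p) hp).const_mul ‖z‖
  refine summable_of_ratio_norm_eventually_le one_half_lt_one ?_
  filter_upwards [hratio.eventually_le_const one_half_pos] with n hn
  rw [Nat.cast_succ, thetaCoeff_add_one hp0 hz, norm_mul, norm_mul, norm_neg, zpow_natCast,
    norm_pow]
  exact mul_le_mul_of_nonneg_right hn (norm_nonneg _)

theorem summable_thetaCoeff (hp : ‖p‖ < 1) (hz : z ≠ 0) :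
    Summable (thetaCoeff p z) := by
  refine .of_nat_of_neg (summable_thetaCoeff_natCast hp0 hp hz) ?_
  simp_rw [thetaCoeff_neg hp0]
  exact summable_thetaCoeff_natCast hp0 hp (div_ne_zero hp0 hz)

end ThetaCoeff

theorem summable_zpow_mul_add {q : ℂ} (hq0 : q ≠ 0) (hq : ‖q‖ < 1) (a : ℤ) :
    Summable fun n : ℤ => q ^ (n * (n + a)) := by
  have h := summable_thetaCoeff (pow_ne_zero 2 hq0) (norm_pow_lt_one hq two_ne_zero)
    (zpow_ne_zero (1 + a) hq0)
  refine .of_norm (h.norm.congr fun n => ?_)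
  rw [thetaCoeff, norm_mul, norm_mul, norm_zpow, norm_neg, norm_one, one_zpow, one_mul, ← norm_mul,
    ← zpow_natCast, ← zpow_mul, ← zpow_mul, ← zpow_add₀ hq0, Nat.cast_two,
    two_mul_mul_pred_div_two]
  ring_nf

/-! ### Bilateral Bailey sums -/

/-- The sum `∑_m c_m / ((q; q)_{i - tm} (q; q)_{j + tm})` over `m ∈ ℤ`, which has finitely many
nonzero terms when `t ≠ 0`. For `i = n` and `j = n + a` it is, up to a constant factor, the `β_n` of
a Bailey pair relative to `q^a` in bilateral form. -/
noncomputable def baileySum (q : ℂ) (t : ℤ) (c : ℤ → ℂ) (i j : ℤ) : ℂ :=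
  ∑' m : ℤ, c m * (invQPoch q (i - t * m) * invQPoch q (j + t * m))

theorem summable_baileySum (q : ℂ) {t : ℤ} (ht : t ≠ 0) (c : ℤ → ℂ) (i j : ℤ) :
    Summable fun m : ℤ => c m * (invQPoch q (i - t * m) * invQPoch q (j + t * m)) := by
  refine summable_of_ne_finset_zero (s := Finset.Icc (-(|i| + |j|)) (|i| + |j|)) fun m hm => ?_
  have hm' : |i| + |j| < |t * m| := by
    rw [Finset.mem_Icc, ← abs_le, not_le] at hm
    rw [abs_mul]
    exact hm.trans_le (le_mul_of_one_le_left (abs_nonneg m) (Int.one_le_abs ht))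
  rcases lt_or_ge (i - t * m) 0 with hi | hi
  · rw [invQPoch_of_neg q hi, zero_mul, mul_zero]
  · rw [invQPoch_of_neg q (k := j + t * m) (by grind), mul_zero, mul_zero]

theorem baileySum_const_mul (q : ℂ) (t : ℤ) (w : ℂ) (c : ℤ → ℂ) (i j : ℤ) :
    baileySum q t (fun m => w * c m) i j = w * baileySum q t c i j := by
  simp only [baileySum, mul_assoc, tsum_mul_left]

theorem baileySum_swap (q : ℂ) (t : ℤ) (c : ℤ → ℂ) (i j : ℤ) :
    baileySum q t c i j = baileySum q t (fun m => c (-m)) j i := by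
  rw [baileySum, baileySum, ← (Equiv.neg ℤ).tsum_eq]
  refine tsum_congr fun m => ?_
  rw [Equiv.neg_apply, mul_neg, sub_neg_eq_add, ← sub_eq_add_neg, mul_comm (invQPoch q (i + _))]

theorem baileySum_shift (q : ℂ) (t : ℤ) (c : ℤ → ℂ) (i j : ℤ) :
    baileySum q t c (i + t) (j - t) = baileySum q t (fun m => c (m + 1)) i j := by
  rw [baileySum, baileySum, ← (Equiv.addRight (1 : ℤ)).tsum_eq]
  refine tsum_congr fun m => ?_
  rw [Equiv.coe_addRight]
  ring_nf

theorem baileySum_zero_zero (q : ℂ) {t : ℤ} (ht : t ≠ 0) (c : ℤ → ℂ) :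
    baileySum q t c 0 0 = c 0 := by
  rw [baileySum, tsum_eq_single 0]
  · simp [invQPoch_zero]
  · intro m hm
    rcases lt_or_gt_of_ne (mul_ne_zero ht hm) with h | h
    · rw [invQPoch_of_neg q (k := 0 + t * m) (by lia), mul_zero, mul_zero]
    · rw [invQPoch_of_neg q (k := 0 - t * m) (by lia), zero_mul, mul_zero]

theorem baileySum_eq_zero_of_lt (q : ℂ) {t : ℤ} (c : ℤ → ℂ) {i j : ℤ} (ht : 0 ≤ t) (hi : i < 0)
    (hj : j < t) : baileySum q t c i j = 0 := by
  have hterm (m : ℤ) : c m * (invQPoch q (i - t * m) * invQPoch q (j + t * m)) = 0 := by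
    rcases lt_or_ge m 0 with hm | hm
    · rw [invQPoch_of_neg q (k := j + t * m) (by nlinarith), mul_zero, mul_zero]
    · rw [invQPoch_of_neg q (k := i - t * m) (by nlinarith), zero_mul, mul_zero]
  simp only [baileySum, hterm, tsum_zero]

theorem baileySum_pascal {q : ℂ} (hq0 : q ≠ 0) (hq : ‖q‖ < 1) {t : ℤ} (ht : t ≠ 0)
    (c : ℤ → ℂ) (i j : ℤ) :
    (1 - q ^ (i + j)) * baileySum q t c i j =
      baileySum q t c i (j - 1) +
        q ^ j * baileySum q t (fun m => c m * q ^ (t * m)) (i - 1) j := by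
  rw [baileySum, baileySum, baileySum, ← tsum_mul_left, ← tsum_mul_left,
    ← (summable_baileySum q ht _ _ _).tsum_add ((summable_baileySum q ht _ _ _).mul_left _)]
  refine tsum_congr fun m => ?_
  have h := invQPoch_pascal hq hq0 (i - t * m) (j + t * m)
  rw [sub_add_add_cancel, zpow_add₀ hq0 j, sub_right_comm, add_sub_right_comm] at h
  linear_combination c m * h

theorem tendsto_baileySum {q : ℂ} (hq : ‖q‖ < 1) (t : ℤ) {c : ℤ → ℂ} (hc : Summable c) :
    Tendsto (fun n : ℕ => baileySum q t c n n) atTop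
      (𝓝 ((∑' m, c m) * ((qPochInf q q)⁻¹ * (qPochInf q q)⁻¹))) := by
  obtain ⟨C, hC⟩ := exists_norm_invQPoch_mul_le hq
  have hcast : Tendsto (fun n : ℕ => (n : ℤ)) atTop atTop := tendsto_natCast_atTop_atTop
  rw [← tsum_mul_right]
  refine tendsto_tsum_of_dominated_convergence (hc.norm.mul_right C)
    (fun m => tendsto_const_nhds.mul (Tendsto.mul ?_ ?_)) (.of_forall fun n m => ?_)
  · exact (tendsto_invQPoch hq).comp (tendsto_atTop_add_const_right _ (-(t * m)) hcast)
  · exact (tendsto_invQPoch hq).comp (tendsto_atTop_add_const_right _ (t * m) hcast)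
  · rw [norm_mul]
    exact mul_le_mul_of_nonneg_left (hC _ _) (norm_nonneg _)

section ThetaBaileySum

variable {q p z : ℂ} {t : ℤ}

theorem baileySum_thetaCoeff_swap (hp : p ≠ 0) (i j : ℤ) :
    baileySum q t (thetaCoeff p z) i j = baileySum q t (thetaCoeff p (p / z)) j i := by
  simp only [baileySum_swap q t (thetaCoeff p z), thetaCoeff_neg hp]

theorem baileySum_thetaCoeff_shift (hp : p ≠ 0) (hz : z ≠ 0) (i j : ℤ) :
    baileySum q t (thetaCoeff p z) (i + t) (j - t) =
      -z * baileySum q t (thetaCoeff p (z * p)) i j := by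
  have h (m : ℤ) : thetaCoeff p z (m + 1) = -z * thetaCoeff p (z * p) m := by
    have hmul := thetaCoeff_mul_zpow p z p 1 m
    rw [zpow_one, one_mul] at hmul
    rw [thetaCoeff_add_one hp hz, ← hmul]
    ring
  simp only [baileySum_shift, h, baileySum_const_mul]

theorem baileySum_thetaCoeff_pascal_right (hq0 : q ≠ 0) (hq : ‖q‖ < 1) (ht : t ≠ 0)
    (i j : ℤ) :
    (1 - q ^ (i + j)) * baileySum q t (thetaCoeff p z) i j =
      baileySum q t (thetaCoeff p z) i (j - 1) +
        q ^ j * baileySum q t (thetaCoeff p (z * q ^ t)) (i - 1) j := by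
  simpa only [thetaCoeff_mul_zpow] using baileySum_pascal hq0 hq ht (thetaCoeff p z) i j

theorem baileySum_thetaCoeff_pascal_left (hq0 : q ≠ 0) (hq : ‖q‖ < 1) (hp : p ≠ 0) (ht : t ≠ 0)
    (i j : ℤ) :
    (1 - q ^ (i + j)) * baileySum q t (thetaCoeff p z) i j =
      baileySum q t (thetaCoeff p z) (i - 1) j +
        q ^ i * baileySum q t (thetaCoeff p (z / q ^ t)) i (j - 1) := by
  have h := baileySum_thetaCoeff_pascal_right (p := p) (z := p / z) hq0 hq ht j i
  rwa [← baileySum_thetaCoeff_swap hp, ← baileySum_thetaCoeff_swap hp, add_comm j,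
    div_mul, ← baileySum_thetaCoeff_swap hp] at h

end ThetaBaileySum

/-! ### The Jacobi triple product -/

section TripleProduct

variable {q z : ℂ} (hq0 : q ≠ 0) (hq : ‖q‖ < 1) (hz : z ≠ 0)
include hq0 hq hz

theorem baileySum_thetaCoeff_self_add_one (n : ℤ) :
    (1 - q ^ (2 * n + 1)) * baileySum q 1 (thetaCoeff q z) n (n + 1) =
      (1 - q / z * q ^ n) * baileySum q 1 (thetaCoeff q z) n n := by
  have h := baileySum_thetaCoeff_pascal_right (p := q) (z := z) hq0 hq one_ne_zero n (n + 1)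
  have hshift := baileySum_thetaCoeff_shift (q := q) (t := 1) hq0 hz (n - 1) (n + 1)
  rw [sub_add_cancel, add_sub_cancel_right] at hshift
  rw [add_sub_cancel_right, zpow_one, ← add_assoc, ← two_mul] at h
  rw [h, hshift, zpow_add_one₀ hq0]
  field_simp
  ring

theorem baileySum_thetaCoeff_add_one_add_one (n : ℤ) :
    (1 - q ^ (2 * n + 2)) * baileySum q 1 (thetaCoeff q z) (n + 1) (n + 1) =
      (1 - z * q ^ n) * baileySum q 1 (thetaCoeff q z) n (n + 1) := by
  have h := baileySum_thetaCoeff_pascal_left (z := z) hq0 hq hq0 one_ne_zero (n + 1) (n + 1)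
  have hshift := baileySum_thetaCoeff_shift (q := q) (t := 1) hq0 (div_ne_zero hz hq0) n (n + 1)
  rw [add_sub_cancel_right, div_mul_cancel₀ z hq0] at hshift
  rw [add_sub_cancel_right, zpow_one, hshift, show n + 1 + (n + 1) = 2 * n + 2 by ring] at h
  rw [h, zpow_add_one₀ hq0]
  field_simp
  ring

/-- MacMahon's finite form of the triple product. -/
theorem baileySum_thetaCoeff_self (n : ℕ) :
    baileySum q 1 (thetaCoeff q z) n n =
      qPoch z q n * qPoch (q / z) q n * invQPoch q (2 * n) := by
  induction n with
  | zero =>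
    simpa [qPoch, invQPoch_zero, thetaCoeff_zero] using
      baileySum_zero_zero q one_ne_zero (thetaCoeff q z)
  | succ n ih =>
    have h₁ := baileySum_thetaCoeff_self_add_one hq0 hq hz n
    have h₂ := baileySum_thetaCoeff_add_one_add_one hq0 hq hz n
    have hinv : invQPoch q (2 * n) =
        (1 - q ^ (2 * (n : ℤ) + 1)) * ((1 - q ^ (2 * (n : ℤ) + 2)) * invQPoch q (2 * n + 2)) := by
      rw [← invQPoch_sub_one hq, add_sub_assoc, show (2 : ℤ) - 1 = 1 by norm_num,
        ← invQPoch_sub_one hq, add_sub_cancel_right]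
    have hne₁ := one_sub_zpow_ne_zero hq (k := 2 * n + 1) (by lia)
    have hne₂ := one_sub_zpow_ne_zero hq (k := 2 * n + 2) (by lia)
    rw [ih, hinv, zpow_natCast] at h₁
    rw [zpow_natCast] at h₂
    refine mul_left_cancel₀ (mul_ne_zero hne₁ hne₂) ?_
    rw [qPoch_succ, qPoch_succ, Nat.cast_succ, mul_add_one (2 : ℤ)]
    linear_combination (1 - q ^ (2 * (n : ℤ) + 1)) * h₂ + (1 - z * q ^ n) * h₁

theorem tsum_thetaCoeff :
    ∑' m, thetaCoeff q z m = qPochInf z q * qPochInf (q / z) q * qPochInf q q := by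
  have htwo : Tendsto (fun n : ℕ => 2 * (n : ℤ)) atTop atTop :=
    tendsto_natCast_atTop_atTop.const_mul_atTop' two_pos
  have hprod : Tendsto (fun n : ℕ => baileySum q 1 (thetaCoeff q z) n n) atTop
      (𝓝 (qPochInf z q * qPochInf (q / z) q * (qPochInf q q)⁻¹)) := by
    simp_rw [baileySum_thetaCoeff_self hq0 hq hz]
    exact ((tendsto_qPoch z hq).mul (tendsto_qPoch _ hq)).mul ((tendsto_invQPoch hq).comp htwo)
  have h := tendsto_nhds_unique (tendsto_baileySum hq 1 (summable_thetaCoeff hq0 hq hz)) hprod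
  have hne := qPochInf_self_ne_zero hq
  field_simp at h
  linear_combination h

end TripleProduct

/-! ### The limiting Bailey lemma -/

section DurfeeRectangle

variable {q : ℂ}

/-- The summand of `∑_n q^{n(n+d)} / ((q; q)_n (q; q)_{n+d})`, which generates partitions by the
size of their Durfee rectangle of excess `d`. -/
noncomputable def durfeeTerm (q : ℂ) (d n : ℤ) : ℂ :=
  q ^ (n * (n + d)) * (invQPoch q n * invQPoch q (n + d))

theorem summable_durfeeTerm (hq0 : q ≠ 0) (hq : ‖q‖ < 1) (d : ℤ) : Summable (durfeeTerm q d) :=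
  summable_mul_invQPoch hq (summable_zpow_mul_add hq0 hq d) id (· + d)

/-- Both sides become `∑_n q^{n(n+d+1)} / ((q; q)_n (q; q)_{n+d})` after subtracting the same
series `∑_n q^{n(n+d)} / ((q; q)_{n-1} (q; q)_{n+d})`, shifted by one on the left. -/
theorem tsum_durfeeTerm_add_one (hq0 : q ≠ 0) (hq : ‖q‖ < 1) (d : ℤ) :
    ∑' n, durfeeTerm q (d + 1) n = ∑' n, durfeeTerm q d n := by
  set lower : ℤ → ℂ := fun n => q ^ (n * (n + d)) * (invQPoch q (n - 1) * invQPoch q (n + d))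
  have hlower : Summable lower :=
    summable_mul_invQPoch hq (summable_zpow_mul_add hq0 hq d) (· - 1) (· + d)
  have hlower' : Summable fun n => lower (n + 1) := (Equiv.addRight (1 : ℤ)).summable_iff.mpr hlower
  have hshift : ∑' n, lower (n + 1) = ∑' n, lower n := (Equiv.addRight (1 : ℤ)).tsum_eq lower
  have hterm (n : ℤ) :
      durfeeTerm q (d + 1) n - lower (n + 1) = durfeeTerm q d n - lower n := by
    have hn := invQPoch_sub_one hq n
    have hnd := invQPoch_sub_one hq (n + (d + 1))
    have hexp₁ : q ^ (n * (n + (d + 1))) = q ^ (n * (n + d)) * q ^ n := by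
      rw [← zpow_add₀ hq0]; ring_nf
    have hexp₂ : q ^ ((n + 1) * (n + 1 + d)) = q ^ (n * (n + d)) * q ^ n * q ^ (n + (d + 1)) := by
      rw [← zpow_add₀ hq0, ← zpow_add₀ hq0]; ring_nf
    rw [← add_assoc, add_sub_cancel_right] at hnd
    simp only [durfeeTerm, lower, add_sub_cancel_right]
    rw [hexp₁, hexp₂, hn, add_assoc n 1 d, add_comm 1 d, hnd, ← add_assoc]
    ring
  have h : ∑' n, (durfeeTerm q (d + 1) n - lower (n + 1)) =
      ∑' n, (durfeeTerm q d n - lower n) := tsum_congr hterm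
  rwa [(summable_durfeeTerm hq0 hq _).tsum_sub hlower',
    (summable_durfeeTerm hq0 hq _).tsum_sub hlower, hshift, sub_left_inj] at h

theorem tendsto_durfeeTerm (hq : ‖q‖ < 1) (n : ℤ) :
    Tendsto (fun d : ℕ => durfeeTerm q d n) atTop
      (𝓝 (if n = 0 then (qPochInf q q)⁻¹ else 0)) := by
  rcases lt_trichotomy n 0 with hn | rfl | hn
  · simp [durfeeTerm, invQPoch_of_neg q hn, hn.ne]
  · simpa [durfeeTerm, invQPoch_zero, Function.comp_def] using
      (tendsto_invQPoch hq).comp tendsto_natCast_atTop_atTop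
  · lift n to ℕ using hn.le
    have hpow : Tendsto (fun d : ℕ => (q ^ n) ^ (n + d)) atTop (𝓝 0) := by
      refine (tendsto_pow_atTop_nhds_zero_of_norm_lt_one (norm_pow_lt_one hq (by lia))).comp ?_
      exact tendsto_atTop_mono (fun d => by lia : ∀ d, d ≤ n + d) tendsto_id
    have hinv : Tendsto (fun d : ℕ => invQPoch q (n + d)) atTop (𝓝 (qPochInf q q)⁻¹) :=
      (tendsto_invQPoch hq).comp <|
        tendsto_atTop_add_const_left _ (n : ℤ) tendsto_natCast_atTop_atTop
    rw [if_neg hn.ne', ← zero_mul (invQPoch q n * (qPochInf q q)⁻¹)]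
    refine (hpow.mul (hinv.const_mul (invQPoch q n))).congr fun d => ?_
    rw [durfeeTerm, zpow_mul, zpow_natCast, ← Nat.cast_add, zpow_natCast]

theorem norm_durfeeTerm_le {C : ℝ} (hq0 : q ≠ 0) (hq : ‖q‖ < 1)
    (hC : ∀ k l, ‖invQPoch q k * invQPoch q l‖ ≤ C) (d : ℕ) (n : ℤ) :
    ‖durfeeTerm q d n‖ ≤ ‖q ^ (n * n)‖ * C := by
  rw [durfeeTerm]
  rcases lt_or_ge n 0 with hn | hn
  · rw [invQPoch_of_neg q hn, zero_mul, mul_zero, norm_zero]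
    exact mul_nonneg (norm_nonneg _) ((norm_nonneg _).trans (hC 0 0))
  · rw [norm_mul, norm_zpow, norm_zpow]
    refine mul_le_mul (zpow_le_zpow_right_of_le_one₀ (norm_pos_iff.mpr hq0) hq.le ?_) (hC _ _)
      (norm_nonneg _) (by positivity)
    exact mul_le_mul_of_nonneg_left (by lia) hn

theorem tsum_durfeeTerm (hq0 : q ≠ 0) (hq : ‖q‖ < 1) (d : ℤ) :
    ∑' n, durfeeTerm q d n = (qPochInf q q)⁻¹ := by
  have hconst (d : ℤ) : ∑' n, durfeeTerm q d n = ∑' n, durfeeTerm q 0 n := by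
    have hper : Function.Periodic (fun d => ∑' n, durfeeTerm q d n) 1 :=
      tsum_durfeeTerm_add_one hq0 hq
    simpa only [Int.cast_id, mul_one] using hper.int_mul_eq d
  obtain ⟨C, hC⟩ := exists_norm_invQPoch_mul_le hq
  have hbound : Summable fun n : ℤ => ‖q ^ (n * n)‖ * C := by
    simpa only [add_zero] using (summable_zpow_mul_add hq0 hq 0).norm.mul_right C
  have hlim : Tendsto (fun d : ℕ => ∑' n, durfeeTerm q d n) atTop (𝓝 (qPochInf q q)⁻¹) := by
    simpa only [tsum_ite_eq] using tendsto_tsum_of_dominated_convergence hbound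
      (tendsto_durfeeTerm hq) (.of_forall fun d => norm_durfeeTerm_le hq0 hq hC d)
  simp only [hconst] at hlim ⊢
  exact tendsto_nhds_unique tendsto_const_nhds hlim

theorem tsum_zpow_mul_invQPoch_sub_mul_invQPoch_add (hq0 : q ≠ 0) (hq : ‖q‖ < 1) (a r : ℤ) :
    ∑' n : ℤ, q ^ (n * (n + a)) * (invQPoch q (n - r) * invQPoch q (n + a + r)) =
      q ^ (r * (r + a)) / qPochInf q q := by
  rw [div_eq_mul_inv, ← tsum_durfeeTerm hq0 hq (2 * r + a),
    ← (Equiv.subRight r).tsum_eq (durfeeTerm q _), ← tsum_mul_left]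
  refine tsum_congr fun n => ?_
  have hexp : n * (n + a) = r * (r + a) + (n - r) * (n - r + (2 * r + a)) := by ring
  rw [Equiv.subRight_apply, durfeeTerm, hexp, zpow_add₀ hq0, mul_assoc]
  ring_nf

end DurfeeRectangle

theorem hasSum_zpow_mul_baileySum {q : ℂ} (hq0 : q ≠ 0) (hq : ‖q‖ < 1) {c : ℤ → ℂ}
    (hc : Summable c) (t a : ℤ) :
    HasSum (fun n : ℤ => q ^ (n * (n + a)) * baileySum q t c n (n + a))
      ((∑' m, c m * q ^ (t * m * (t * m + a))) / qPochInf q q) := by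
  set term : ℤ × ℤ → ℂ := fun x => q ^ (x.1 * (x.1 + a)) * c x.2 *
    (invQPoch q (x.1 - t * x.2) * invQPoch q (x.1 + a + t * x.2)) with hterm
  have hsum : Summable term := summable_mul_invQPoch hq
    (summable_mul_of_summable_norm (summable_zpow_mul_add hq0 hq a).norm hc.norm) _ _
  have hcol (m : ℤ) :
      ∑' n, term (n, m) = c m * q ^ (t * m * (t * m + a)) / qPochInf q q := by
    rw [mul_div_assoc, ← tsum_zpow_mul_invQPoch_sub_mul_invQPoch_add hq0 hq, ← tsum_mul_left]
    exact tsum_congr fun n => by simp only [hterm]; ring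
  have hrow (n : ℤ) :
      ∑' m, term (n, m) = q ^ (n * (n + a)) * baileySum q t c n (n + a) := by
    rw [baileySum, ← tsum_mul_left]
    exact tsum_congr fun m => by simp only [hterm]; ring
  have htotal : ∑' x, term x = (∑' m, c m * q ^ (t * m * (t * m + a))) / qPochInf q q := by
    have hcomm : ∑' n, ∑' m, term (n, m) = ∑' m, ∑' n, term (n, m) :=
      (Summable.tsum_comm (f := fun n m => term (n, m)) hsum).symm
    rw [hsum.tsum_prod, hcomm, tsum_congr hcol, tsum_div_const]
  simpa only [htotal, hrow] using
    hsum.hasSum.prod_fiberwise fun n => (hsum.prod_factor n).hasSum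

/-! ### The Bailey pair with `β_n = 1 / ((q; q)_n (q; q²)_{n+1})` -/

/-- The Bailey sum with step `2` and coefficients `(-1)^m q^{3m² + m}`. At `(n, n + 1)` it is the
`β_n` of the Bailey pair behind Slater's identities (59) and (60). -/
noncomputable def slaterSum (q : ℂ) (i j : ℤ) : ℂ :=
  baileySum q 2 (thetaCoeff (q ^ 6) (q ^ 4)) i j

/-- The companion of `slaterSum` with coefficients `(-1)^m q^{3m² + 3m}`. These are odd under
`m ↦ -1 - m`, which makes some of its values vanish. -/
noncomputable def slaterSumOdd (q : ℂ) (i j : ℤ) : ℂ :=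
  baileySum q 2 (thetaCoeff (q ^ 6) (q ^ 6)) i j

section SlaterSum

variable {q : ℂ} (hq0 : q ≠ 0)

include hq0 in
theorem slaterSumOdd_reflect (i j : ℤ) :
    slaterSumOdd q (j - 2) (i + 2) = -slaterSumOdd q i j := by
  have hp : q ^ 6 ≠ 0 := pow_ne_zero 6 hq0
  have hshift := baileySum_thetaCoeff_shift (q := q) (t := 2) hp one_ne_zero (j - 2) (i + 2)
  rw [sub_add_cancel, add_sub_cancel_right, one_mul, ← div_self hp,
    ← baileySum_thetaCoeff_swap hp, div_self hp] at hshift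
  rw [slaterSumOdd, slaterSumOdd, hshift, neg_one_mul, neg_neg]

include hq0 in
theorem slaterSumOdd_self_add_two (i : ℤ) : slaterSumOdd q i (i + 2) = 0 := by
  have h := slaterSumOdd_reflect hq0 i (i + 2)
  rwa [add_sub_cancel_right, self_eq_neg] at h

variable (hq : ‖q‖ < 1)
include hq0 hq

theorem slaterSum_pascal_right (i j : ℤ) :
    (1 - q ^ (i + j)) * slaterSum q i j =
      slaterSum q i (j - 1) + q ^ j * slaterSumOdd q (i - 1) j := by
  have h := baileySum_thetaCoeff_pascal_right (p := q ^ 6) (z := q ^ 4) hq0 hq two_ne_zero i j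
  rwa [zpow_ofNat, ← pow_add] at h

theorem slaterSum_pascal_left (i j : ℤ) :
    (1 - q ^ (i + j)) * slaterSum q i j =
      slaterSum q (i - 1) j + q ^ i * slaterSum q (j - 1) i := by
  have hp : q ^ 6 ≠ 0 := pow_ne_zero 6 hq0
  have h := baileySum_thetaCoeff_pascal_left (z := q ^ 4) hq0 hq hp two_ne_zero i j
  have hz : q ^ 6 / (q ^ 4 / q ^ (2 : ℤ)) = q ^ 4 := by
    rw [zpow_ofNat]
    field_simp
  rwa [baileySum_thetaCoeff_swap hp i (j - 1), hz] at h

theorem slaterSumOdd_pascal_left (i j : ℤ) :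
    (1 - q ^ (i + j)) * slaterSumOdd q i j =
      slaterSumOdd q (i - 1) j + q ^ i * slaterSum q i (j - 1) := by
  have h := baileySum_thetaCoeff_pascal_left (z := q ^ 6) hq0 hq (pow_ne_zero 6 hq0)
    two_ne_zero i j
  have hz : q ^ 6 / q ^ (2 : ℤ) = q ^ 4 := by
    rw [zpow_ofNat]
    field_simp
  rwa [hz] at h

theorem slaterSum_self_add_one (n : ℤ) :
    (1 - q ^ (2 * n + 1)) * slaterSum q n (n + 1) = slaterSum q n n := by
  have hodd := slaterSumOdd_self_add_two hq0 (n - 1)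
  have h := slaterSum_pascal_right hq0 hq n (n + 1)
  rw [show n - 1 + 2 = n + 1 by ring] at hodd
  rwa [hodd, mul_zero, add_zero, add_sub_cancel_right, ← add_assoc, ← two_mul] at h

theorem slaterSum_add_one_self (n : ℤ) :
    (1 - q ^ (2 * n + 2)) * slaterSum q (n + 1) (n + 1) =
      (1 + q ^ (n + 1)) * slaterSum q n (n + 1) := by
  have h := slaterSum_pascal_left hq0 hq (n + 1) (n + 1)
  rwa [add_sub_cancel_right, ← one_add_mul, show n + 1 + (n + 1) = 2 * n + 2 by ring] at h

theorem slaterSumOdd_self_add_one {n : ℤ} (hn : 0 ≤ n) :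
    slaterSumOdd q n (n + 1) = q ^ n * slaterSum q n (n + 1) := by
  have hodd := slaterSumOdd_self_add_two hq0 (n - 1)
  have h := slaterSumOdd_pascal_left hq0 hq n (n + 1)
  rw [show n - 1 + 2 = n + 1 by ring] at hodd
  rw [hodd, zero_add, add_sub_cancel_right, ← add_assoc, ← two_mul,
    ← slaterSum_self_add_one hq0 hq, mul_left_comm] at h
  exact mul_left_cancel₀ (one_sub_zpow_ne_zero hq (by lia)) h

theorem slaterSum_self_add_two {n : ℤ} (hn : 0 ≤ n) :
    slaterSum q n (n + 2) = slaterSum q n (n + 1) := by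
  have hodd := slaterSumOdd_reflect hq0 n (n + 1)
  have h := slaterSum_pascal_right hq0 hq n (n + 2)
  rw [slaterSumOdd_self_add_one hq0 hq hn, show n + 1 - 2 = n - 1 by ring] at hodd
  rw [hodd, show n + 2 - 1 = n + 1 by ring] at h
  refine mul_left_cancel₀ (one_sub_zpow_ne_zero hq (k := n + (n + 2)) (by lia)) ?_
  have hexp : q ^ (n + (n + 2)) = q ^ n * q ^ (n + 2) := zpow_add₀ hq0 n (n + 2)
  linear_combination h + slaterSum q n (n + 1) * hexp

theorem slaterSum_mul_qPoch (n : ℕ) :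
    slaterSum q n (n + 1) * (qPoch q q n * qPoch q (q ^ 2) (n + 1)) = 1 := by
  induction n with
  | zero =>
    have h := slaterSum_self_add_one hq0 hq 0
    rw [slaterSum, slaterSum, baileySum_zero_zero q two_ne_zero, thetaCoeff_zero] at h
    simpa [slaterSum, qPoch, mul_comm] using h
  | succ n ih =>
    have hodd := slaterSum_self_add_one hq0 hq (n + 1)
    have heven := slaterSum_add_one_self hq0 hq n
    have hexp : 2 * ((n : ℤ) + 1) + 1 = (2 * (n + 1) + 1 : ℕ) := by push_cast; ring
    have hexp' : 2 * (n : ℤ) + 2 = (2 * (n + 1) : ℕ) := by push_cast; ring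
    rw [hexp, zpow_natCast] at hodd
    rw [hexp', zpow_natCast, ← Nat.cast_add_one, zpow_natCast] at heven
    refine mul_left_cancel₀ (one_add_pow_ne_zero hq (k := n + 1) (by lia)) ?_
    rw [qPoch_succ q (q ^ 2) (n + 1), qPoch_succ q q n, ← pow_succ', ← pow_mul, ← pow_succ']
    push_cast at hodd heven ⊢
    linear_combination
      (1 - q ^ (2 * (n + 1))) * (qPoch q q n * qPoch q (q ^ 2) (n + 1)) * hodd +
      qPoch q q n * qPoch q (q ^ 2) (n + 1) * heven + (1 + q ^ (n + 1)) * ih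

theorem slaterSum_eq_inv (n : ℕ) :
    slaterSum q n (n + 1) = (qPoch q q n * qPoch q (q ^ 2) (n + 1))⁻¹ :=
  eq_inv_of_mul_eq_one_left (slaterSum_mul_qPoch hq0 hq n)

/-! ### Slater's identities modulo 14 -/

theorem hasSum_pow_mul_slaterSum {a : ℕ} (ha : a < 3) :
    HasSum (fun n : ℕ => q ^ (n * (n + a)) * slaterSum q n (n + a))
      (qPochInf (q ^ (8 + 2 * a)) (q ^ 14) * qPochInf (q ^ 14 / q ^ (8 + 2 * a)) (q ^ 14) *
        qPochInf (q ^ 14) (q ^ 14) / qPochInf q q) := by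
  have hcoeff (m : ℤ) : thetaCoeff (q ^ 6) (q ^ 4) m * q ^ (2 * m * (2 * m + a)) =
      thetaCoeff (q ^ 14) (q ^ (8 + 2 * a)) m := by
    have hexp : 2 * m * (2 * m + a) = 4 * (m * (m - 1)) + (4 + 2 * a) * m := by ring
    rw [hexp, zpow_add₀ hq0, ← mul_assoc, thetaCoeff_mul_zpow_mul_pred, thetaCoeff_mul_zpow]
    congr 1
    · rw [← zpow_natCast, ← zpow_natCast, ← zpow_add₀ hq0]; norm_num
    · rw [← zpow_natCast, ← zpow_natCast, ← zpow_add₀ hq0]; push_cast; ring_nf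
  have h := hasSum_zpow_mul_baileySum hq0 hq (summable_thetaCoeff (pow_ne_zero 6 hq0)
    (norm_pow_lt_one hq (by norm_num)) (pow_ne_zero 4 hq0)) 2 a
  rw [tsum_congr hcoeff, tsum_thetaCoeff (pow_ne_zero _ hq0) (norm_pow_lt_one hq (by norm_num))
    (pow_ne_zero _ hq0), ← Nat.cast_injective.hasSum_iff] at h
  · exact_mod_cast h
  · intro n hn
    have hneg : n < 0 := by
      by_contra! hn0
      exact hn ⟨n.toNat, Int.toNat_of_nonneg hn0⟩
    rw [baileySum_eq_zero_of_lt q _ zero_le_two hneg (by lia), mul_zero]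

theorem hasSum_slater_60 :
    HasSum (fun n : ℕ => q ^ (n * (n + 1)) / (qPoch q q n * qPoch q (q ^ 2) (n + 1)))
      (qPochInf (q ^ 4) (q ^ 14) * qPochInf (q ^ 10) (q ^ 14) * qPochInf (q ^ 14) (q ^ 14) /
        qPochInf q q) := by
  have hdiv : q ^ 14 / q ^ 10 = q ^ 4 := by field_simp
  have h := hasSum_pow_mul_slaterSum hq0 hq (a := 1) (by norm_num)
  simp only [Nat.cast_one, slaterSum_eq_inv hq0 hq, ← div_eq_mul_inv, mul_one, Nat.reduceAdd,
    hdiv] at h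
  rwa [mul_comm (qPochInf (q ^ 4) _)]

theorem hasSum_slater_59 :
    HasSum (fun n : ℕ => q ^ (n * (n + 2)) / (qPoch q q n * qPoch q (q ^ 2) (n + 1)))
      (qPochInf (q ^ 2) (q ^ 14) * qPochInf (q ^ 12) (q ^ 14) * qPochInf (q ^ 14) (q ^ 14) /
        qPochInf q q) := by
  have hdiv : q ^ 14 / q ^ 12 = q ^ 2 := by field_simp
  have h := hasSum_pow_mul_slaterSum hq0 hq (a := 2) (by norm_num)
  simp only [Nat.cast_ofNat, slaterSum_self_add_two hq0 hq (Int.natCast_nonneg _),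
    slaterSum_eq_inv hq0 hq, ← div_eq_mul_inv, Nat.reduceMul, Nat.reduceAdd, hdiv] at h
  rwa [mul_comm (qPochInf (q ^ 2) _)]

end SlaterSum

theorem qPoch_neg_mul_qPoch_two_mul_add_one (q : ℂ) (n : ℕ) :
    qPoch (-q) (q ^ 2) n * qPoch q q (2 * n + 1) * (1 + q ^ (2 * n + 1)) =
      qPoch (q ^ 2) (q ^ 2) n * qPoch (q ^ 2) ((q ^ 2) ^ 2) (n + 1) := by
  rw [qPoch_two_mul_add_one, ← sq q, ← qPoch_neg_mul_qPoch q (q ^ 2) (n + 1),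
    qPoch_succ (-q)]
  ring

theorem pow_div_qPoch_eq_add {q : ℂ} (hq : ‖q‖ < 1) (n : ℕ) :
    q ^ (2 * n ^ 2 + 2 * n) / (qPoch (-q) (q ^ 2) n * qPoch q q (2 * n + 1)) =
      (q ^ 2) ^ (n * (n + 1)) / (qPoch (q ^ 2) (q ^ 2) n * qPoch (q ^ 2) ((q ^ 2) ^ 2) (n + 1)) +
        q * ((q ^ 2) ^ (n * (n + 2)) /
          (qPoch (q ^ 2) (q ^ 2) n * qPoch (q ^ 2) ((q ^ 2) ^ 2) (n + 1))) := by
  rw [← mul_div_mul_right _ _ (one_add_pow_ne_zero hq (k := 2 * n + 1) (by lia)),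
    qPoch_neg_mul_qPoch_two_mul_add_one]
  ring

theorem mainTheorem3 (q : ℂ) (hq : ‖q‖ < 1) :
    HasSum
      (fun n : ℕ =>
        q ^ (2 * n ^ 2 + 2 * n) / (qPoch (-q) (q ^ 2) n * qPoch q q (2 * n + 1)))
      ((qPochInf (q ^ 8) (q ^ 28) * qPochInf (q ^ 20) (q ^ 28) * qPochInf (q ^ 28) (q ^ 28)
          + q * (qPochInf (q ^ 4) (q ^ 28) * qPochInf (q ^ 24) (q ^ 28)
            * qPochInf (q ^ 28) (q ^ 28)))
        / qPochInf (q ^ 2) (q ^ 2)) := by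
  rcases eq_or_ne q 0 with rfl | hq0
  · have hzero (n : ℕ) (hn : n ≠ 0) : (0 : ℂ) ^ (2 * n ^ 2 + 2 * n) /
        (qPoch (-0) (0 ^ 2) n * qPoch 0 0 (2 * n + 1)) = 0 := by simp [hn]
    simpa [qPoch, qPochInf] using hasSum_single 0 hzero
  have hsq0 : q ^ 2 ≠ 0 := pow_ne_zero 2 hq0
  have hsq : ‖q ^ 2‖ < 1 := norm_pow_lt_one hq two_ne_zero
  have h := (hasSum_slater_60 hsq0 hsq).add ((hasSum_slater_59 hsq0 hsq).mul_left q)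
  simp_rw [pow_div_qPoch_eq_add hq]
  convert h using 1
  simp only [← pow_mul, Nat.reduceMul]
  ring
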